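/- A planar doodle diagram is a finite connected 4-valent graph $D$ with at least one vertex (loops and parallel edges allowed) embedded in the sphere $S^2$; its vertices are called crossings, and the components of $S^2\setminus D$, which are open 2-cells, are called regions. It is minimal if every region has at least three sides (no monogons or bigons). A graph is $k$-connected if it has more than $k$ vertices and is not disconnected by the removal of fewer than $k$ vertices. A doodle is identified with its minimal diagram, and is called prime if this diagram is 3-connected. The dual graph $\Gamma$ of $D$ has one vertex for each region of $D$ and one edge for each edge of $D$, the edge dual to $e$ joining the (vertices corresponding to the) regions on the two sides of $e$. It divides the sphere into four-sided cells, one for each crossing $c$; the vertices and edges of that cell are the regions at $c$ and the duals of the edges at $c$. If a region $R$ is chosen as the infinite region, with corresponding vertex $v_\infty$ of $\Gamma$, the boundary of $\Gamma$ relative to $v_\infty$ is the link of $v_\infty$: the subgraph of $\Gamma$ consisting of all vertices and edges that lie in a cell containing $v_\infty$, other than $v_\infty$ itself and the edges ending at $v_\infty$. **Lemma.** Let $D$ be a minimal planar doodle diagram that is 2-connected. Then $D$ is prime if and only if, for every choice of infinite region $R$ of $D$, the boundary of the dual graph $\Gamma$ relative to $v_\infty$ is an embedded circle (that is, a cycle: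 its vertices and edges can be listed without repetition in a cyclic order $x_0,y_0,x_1,y_1,\dots,x_{m-1},y_{m-1}$, $m\ge 1$, with $y_i$ joining $x_i$ to $x_{i+1}$, indices modulo $m$). -/

import Mathlib

/-- A finite graph (loops and parallel edges allowed) cellularly embedded in a closed oriented
surface, given by its rotation system. The elements of `δ` are the darts (edges with a direction),
`rot` sends a dart to the next one counterclockwise around its initial vertex, and `rev` reverses
the direction of a dart. -/
structure SurfaceMap (δ : Type*) where
  rot : Equiv.Perm δ
  rev : Equiv.Perm δ
  rev_rev : ∀ d, rev (rev d) = d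
  rev_ne : ∀ d, rev d ≠ d

namespace SurfaceMap

variable {δ : Type*} (M : SurfaceMap δ)

/-- Walking along `d` with a region on the left-hand side, `M.next d` is the next dart of the
boundary of that region. -/
def next : Equiv.Perm δ := M.rot⁻¹ * M.rev

/-- Vertices (crossings) are the orbits of `rot`. -/
def Crossing : Type _ := Quotient (Equiv.Perm.SameCycle.setoid M.rot)

/-- Edges are the orbits `{d, rev d}` of `rev`. -/
def Edge : Type _ := Quotient (Equiv.Perm.SameCycle.setoid M.rev)

/-- Regions are the orbits of `next`: the closed walks around the complementary 2-cells. -/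
def Region : Type _ := Quotient (Equiv.Perm.SameCycle.setoid M.next)

/-- The crossing from which the dart `d` starts. -/
def source (d : δ) : M.Crossing := Quotient.mk _ d

/-- The undirected edge underlying the dart `d`. -/
def edge (d : δ) : M.Edge := Quotient.mk _ d

/-- The region to the left of the dart `d`; it contains the corner at `M.source d` between `d`
and `M.rot d`. -/
def left (d : δ) : M.Region := Quotient.mk _ d

/-- Adjacency of distinct crossings. Loops and parallel edges play no role in connectivity. -/
def graph : SimpleGraph M.Crossing where
  Adj u v := u ≠ v ∧ ∃ d, M.source d = u ∧ M.source (M.rev d) = v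
  symm := ⟨by
    rintro u v ⟨h, d, hu, hv⟩
    exact ⟨h.symm, M.rev d, hv, by rw [M.rev_rev]; exact hu⟩⟩
  loopless := ⟨fun _ h => h.1 rfl⟩

/-- The crossing `c` lies on the boundary of the region `R`. -/
def OnRegion (c : M.Crossing) (R : M.Region) : Prop :=
  ∃ d, M.source d = c ∧ M.left d = R

/-- The crossing `c` is an end of the edge `e`. -/
def OnEdge (c : M.Crossing) (e : M.Edge) : Prop :=
  ∃ d, M.source d = c ∧ M.edge d = e

/-- The number of sides of a region: `R` is an `M.sides R`-gon. -/
noncomputable def sides (R : M.Region) : ℕ := {d | M.left d = R}.ncard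

theorem edge_eq_iff (d d' : δ) : M.edge d = M.edge d' ↔ d' = d ∨ d' = M.rev d := by
  have hinv : M.rev⁻¹ = M.rev := by
    ext d
    rw [Equiv.Perm.inv_eq_iff_eq, M.rev_rev]
  have h2 : M.rev * M.rev = 1 := by
    ext d
    exact M.rev_rev d
  constructor
  · intro h
    obtain ⟨i, hi⟩ : M.rev.SameCycle d d' := Quotient.exact h
    rcases Int.even_or_odd' i with ⟨k, rfl | rfl⟩
    · left
      rw [zpow_mul, zpow_two, h2, one_zpow] at hi
      exact hi.symm
    · right
      rw [zpow_add, zpow_mul, zpow_two, h2, one_zpow, one_mul, zpow_one] at hi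
      exact hi.symm
  · rintro (rfl | rfl)
    · rfl
    · exact Quotient.sound ⟨1, by simp⟩

/-- The dual graph: one vertex for each region, one edge for each edge; the edge dual to `e` joins
the regions on the two sides of `e`. Its 2-cells correspond to the crossings. -/
def dual : Graph M.Region M.Edge where
  vertexSet := Set.univ
  IsLink e R S := ∃ d, M.edge d = e ∧ M.left d = R ∧ M.left (M.rev d) = S
  isLink_symm := by
    intro e _
    refine ⟨?_⟩
    rintro R S ⟨d, he, hR, hS⟩
    refine ⟨M.rev d, ?_, hS, by rw [M.rev_rev]; exact hR⟩
    rw [← he, M.edge_eq_iff]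
    exact Or.inr (M.rev_rev d).symm
  eq_or_eq_of_isLink_of_isLink := by
    rintro e R S T U ⟨d, he, hR, hS⟩ ⟨d', he', hT, hU⟩
    rcases (M.edge_eq_iff d d').1 (he.trans he'.symm) with rfl | rfl
    · exact Or.inl (hR.symm.trans hT)
    · rw [M.rev_rev] at hU
      exact Or.inr (hR.symm.trans hU)
  left_mem_of_isLink := fun _ _ _ _ => Set.mem_univ _

theorem left_next (d : δ) : M.left (M.next d) = M.left d :=
  (Quotient.sound (⟨1, by simp⟩ : M.next.SameCycle d (M.next d))).symm

theorem source_next (d : δ) : M.source (M.next d) = M.source (M.rev d) :=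
  Quotient.sound (⟨1, by simp [next]⟩ : M.rot.SameCycle (M.next d) (M.rev d))

/-- The boundary of the dual graph relative to the vertex `R` ("infinite vertex"), that is, the
link of `R`. The 2-cell of the dual graph corresponding to a crossing `c` has as its vertices the
regions at `c` and as its edges the duals of the edges at `c`. The link consists of all vertices
and edges that lie in a common 2-cell with `R`, other than `R` itself and the edges ending
in `R`. -/
def boundary (R : M.Region) : Graph M.Region M.Edge where
  vertexSet := {S | S ≠ R ∧ ∃ c, M.OnRegion c R ∧ M.OnRegion c S}
  IsLink e S T :=
    M.dual.IsLink e S T ∧ ¬ M.dual.Inc e R ∧ ∃ c, M.OnRegion c R ∧ M.OnEdge c e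
  isLink_symm := fun _ _ => ⟨fun _ _ h => ⟨h.1.symm, h.2⟩⟩
  eq_or_eq_of_isLink_of_isLink := fun _ _ _ _ _ h h' =>
    M.dual.eq_or_eq_of_isLink_of_isLink h.1 h'.1
  left_mem_of_isLink := by
    rintro e S T ⟨h, hR, c, hc, d', hd', he'⟩
    refine ⟨fun hS => hR ⟨T, hS ▸ h⟩, c, hc, ?_⟩
    obtain ⟨d, he, hS, -⟩ := h
    rcases (M.edge_eq_iff d d').1 (he.trans he'.symm) with rfl | rfl
    · exact ⟨_, hd', hS⟩
    · exact ⟨M.next d, (M.source_next d).trans hd', (M.left_next d).trans hS⟩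

end SurfaceMap

/-- A (nontrivial, irreducible, unoriented) planar doodle diagram: a connected 4-valent graph in
the sphere. For a connected graph, the surface is the sphere exactly when Euler's formula
`V - E + F = 2` holds. -/
structure DoodleDiagram (δ : Type*) [Finite δ] extends SurfaceMap δ where
  four_valent : ∀ c : toSurfaceMap.Crossing, {d | toSurfaceMap.source d = c}.ncard = 4
  connected : toSurfaceMap.graph.Connected
  euler : Nat.card toSurfaceMap.Crossing + Nat.card toSurfaceMap.Region =
    Nat.card toSurfaceMap.Edge + 2

/-- A graph is `k`-connected if it has more than `k` vertices and is not disconnected by the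
removal of fewer than `k` vertices. -/
def IsKConnected {V : Type*} (k : ℕ) (G : SimpleGraph V) : Prop :=
  k < Nat.card V ∧ ∀ S : Finset V, S.card < k → (G.induce (↑S : Set V)ᶜ).Connected

namespace DoodleDiagram

variable {δ : Type*} [Finite δ] (D : DoodleDiagram δ)

/-- A diagram is minimal if it has no monogons and no bigons. -/
def IsMinimal : Prop := ∀ R : D.Region, 3 ≤ D.sides R

/-- A doodle is prime if it is 3-connected. -/
def IsPrime : Prop := IsKConnected 3 D.graph

end DoodleDiagram

/-- A multigraph is a circle if its vertices and edges can be arranged, without repetition, in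
cyclic order `x₀, y₀, x₁, y₁, …, xₙ₋₁, yₙ₋₁` with `n ≥ 1`, such that `yᵢ` joins `xᵢ` to `xᵢ₊₁`
(indices modulo `n`). -/
def IsCircle {α β : Type*} (G : Graph α β) : Prop :=
  ∃ n : ℕ, 0 < n ∧ ∃ (x : ZMod n → α) (y : ZMod n → β),
    Function.Injective x ∧ Function.Injective y ∧
    Set.range x = G.vertexSet ∧ Set.range y = G.edgeSet ∧
    ∀ i, G.IsLink (y i) (x i) (x (i + 1))

/-! ### Darts, orbits and four-valency -/

namespace SurfaceMap

variable {δ : Type*} (M : SurfaceMap δ)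

/-! Both sides of the equivalence are compared with a statement about regions. Two-connectivity and
the absence of monogons make each region visit a crossing at most once (`region_simple`). Given
this, primeness and the circle condition both amount to `RegionsMeetOnce`: two regions at a crossing
u meet again at v only if an edge from u to v separates them.

The Jordan curve theorem enters mod 2. Euler's formula kills the first cohomology
(`exists_potential`), so a closed curve meeting the diagram only at crossings, pushed off them,
gives a mod 2 function on crossings that jumps exactly along the edges crossed an odd number of
times. Draw the curve through two regions meeting at u and v. If deleting u and v leaves a connected
graph, one side of the curve contains no crossing, so its darts at u all run to v; without bigons
there is just one (`meetOnce_of_connected`). Conversely, a region at u that misses v keeps the far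
ends of its two edges at u in one component after deletion, and too few regions at u meet v for {u,
v} to separate (`preconnected_compl_pair`).

The link of R is traced by a closed walk with two steps per corner of R. It never backtracks and
never repeats an edge in the same direction, so in a circle it goes round just once
(`IsCircle.injective_of_walk`). Hence the link is a circle iff the regions on the walk are distinct;
for all R together this is `RegionsMeetOnce`. -/

theorem source_rot (d : δ) : M.source (M.rot d) = M.source d :=
  (Quotient.sound (⟨1, by simp⟩ : M.rot.SameCycle d (M.rot d))).symm

theorem rot_next (d : δ) : M.rot (M.next d) = M.rev d := by simp [next]

theorem next_rev_rot (d : δ) : M.next (M.rev (M.rot d)) = d := by simp [next, M.rev_rev]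

theorem left_rev_rot (d : δ) : M.left (M.rev (M.rot d)) = M.left d := by
  rw [← M.left_next, M.next_rev_rot]

theorem edge_rev (d : δ) : M.edge (M.rev d) = M.edge d := by
  rw [M.edge_eq_iff]; exact Or.inr (M.rev_rev d).symm

instance [Finite δ] : Finite M.Crossing := Quotient.finite _
instance [Finite δ] : Finite M.Edge := Quotient.finite _
instance [Finite δ] : Finite M.Region := Quotient.finite _

theorem source_surjective : Function.Surjective M.source := Quotient.mk_surjective
theorem edge_surjective : Function.Surjective M.edge := Quotient.mk_surjective
theorem left_surjective : Function.Surjective M.left := Quotient.mk_surjective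

/-- On a finite map, a property of darts that `next` preserves holds throughout a region once it
holds at one of its darts. -/
theorem left_induction [Finite δ] {p : δ → Prop} (hp : ∀ d, p d → p (M.next d)) {d d' : δ}
    (h : M.left d = M.left d') (hd : p d) : p d' := by
  obtain ⟨i, rfl⟩ := (Quotient.exact h : M.next.SameCycle d d').exists_nat_pow_eq
  clear h
  induction i with
  | zero => simpa using hd
  | succ n ih => rw [pow_succ']; exact hp _ ih

theorem source_induction [Finite δ] {p : δ → Prop} (hp : ∀ d, p d → p (M.rot d)) {d d' : δ}
    (h : M.source d = M.source d') (hd : p d) : p d' := by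
  obtain ⟨i, rfl⟩ := (Quotient.exact h : M.rot.SameCycle d d').exists_nat_pow_eq
  clear h
  induction i with
  | zero => simpa using hd
  | succ n ih => rw [pow_succ']; exact hp _ ih

theorem sides_le_card (d : δ) (s : Finset δ) [Finite δ] (hd : d ∈ s)
    (hs : ∀ x ∈ s, M.next x ∈ s) : M.sides (M.left d) ≤ s.card := by
  have hsub : {x | M.left x = M.left d} ⊆ (s : Set δ) := fun x hx =>
    M.left_induction (p := fun x => x ∈ s) hs (Eq.symm hx) hd
  exact (Set.ncard_le_ncard hsub s.finite_toSet).trans (Set.ncard_coe_finset s).le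

theorem next_ne_self [Finite δ] (h : ∀ R, 3 ≤ M.sides R) (d : δ) : M.next d ≠ d := by
  intro hd
  have := M.sides_le_card d {d} (by simp) (by simp [hd])
  have := h (M.left d)
  simp at *
  omega

theorem next_next_ne_self [Finite δ] (h : ∀ R, 3 ≤ M.sides R) (d : δ) :
    M.next (M.next d) ≠ d := by
  classical
  intro hd
  have := M.sides_le_card d {d, M.next d} (by simp) (by simp [hd])
  have := h (M.left d)
  have := Finset.card_le_two (a := d) (b := M.next d)
  omega

/-- Every crossing has exactly four darts, listed by `rot`. -/
structure IsFourValent : Prop where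
  rot_four : ∀ d, M.rot (M.rot (M.rot (M.rot d))) = d
  rot_ne : ∀ d, M.rot d ≠ d
  rot_two_ne : ∀ d, M.rot (M.rot d) ≠ d

/-- The darts at a crossing form one `rot`-orbit, so their number is the minimal period of `rot`
there. -/
theorem isFourValent_of_ncard [Finite δ] (h : ∀ c, {d | M.source d = c}.ncard = 4) :
    M.IsFourValent := by
  have key : ∀ d, Function.minimalPeriod M.rot d = 4 := by
    intro d
    have hpos : 0 < Function.minimalPeriod M.rot d :=
      Function.minimalPeriod_pos_of_mem_periodicPts
        (Function.Injective.mem_periodicPts M.rot.injective d)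
    have hset : {x | M.source x = M.source d} =
        (fun i => M.rot^[i] d) '' Set.Iio (Function.minimalPeriod M.rot d) := by
      ext x
      constructor
      · intro hx
        refine M.source_induction (p := fun x => x ∈ (fun i => M.rot^[i] d) ''
          Set.Iio (Function.minimalPeriod M.rot d)) ?_ (Eq.symm hx) ⟨0, hpos, rfl⟩
        rintro _ ⟨i, -, rfl⟩
        refine ⟨(i + 1) % Function.minimalPeriod M.rot d, Nat.mod_lt _ hpos, ?_⟩
        simp only [Function.iterate_mod_minimalPeriod_eq]
        exact Function.iterate_succ_apply' _ _ _
      · rintro ⟨i, -, rfl⟩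
        induction i with
        | zero => rfl
        | succ n ih =>
          simp only [Function.iterate_succ_apply']
          exact (M.source_rot _).trans ih
    have hc := h (M.source d)
    rw [hset, Function.iterate_injOn_Iio_minimalPeriod.ncard_image] at hc
    simpa using hc
  refine ⟨fun d => ?_, fun d hd => ?_, fun d hd => ?_⟩
  · have := Function.iterate_minimalPeriod (f := M.rot) (x := d)
    rwa [key] at this
  · have : Function.IsPeriodicPt M.rot 1 d := hd
    have := this.minimalPeriod_le one_pos
    rw [key] at this; omega
  · have : Function.IsPeriodicPt M.rot 2 d := hd
    have := this.minimalPeriod_le two_pos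
    rw [key] at this; omega

variable {M}

theorem IsFourValent.rot_three_ne (h : M.IsFourValent) (d : δ) :
    M.rot (M.rot (M.rot d)) ≠ d := fun hd => h.rot_ne d (by
  have := h.rot_four d
  rwa [hd] at this)

theorem IsFourValent.eq_of_source_eq [Finite δ] (h : M.IsFourValent) {d d' : δ}
    (hd : M.source d' = M.source d) :
    d' = d ∨ d' = M.rot d ∨ d' = M.rot (M.rot d) ∨ d' = M.rot (M.rot (M.rot d)) := by
  refine M.source_induction (p := fun d' => d' = d ∨ d' = M.rot d ∨ d' = M.rot (M.rot d) ∨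
    d' = M.rot (M.rot (M.rot d))) ?_ hd.symm (Or.inl rfl)
  rintro x (rfl | rfl | rfl | rfl)
  · simp
  · simp
  · simp
  · simp [h.rot_four]

end SurfaceMap
-- Vanishing of the first cohomology mod 2
open scoped Matrix
namespace SurfaceMap

variable {δ : Type*} (M : SurfaceMap δ)

open Classical in
/-- Incidence matrix between the fibres of two functions on a common finite set, mod 2. -/
noncomputable def incidence {α β : Type*} [Fintype δ] (p : δ → α) (q : δ → β) :
    Matrix α β (ZMod 2) :=
  Matrix.of fun a b => ∑ d, if p d = a ∧ q d = b then 1 else 0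

theorem incidence_transpose {α β : Type*} [Fintype δ] (p : δ → α) (q : δ → β) :
    (incidence p q)ᵀ = incidence q p := by
  ext a b
  refine Finset.sum_congr rfl fun d _ => ?_
  by_cases h : p d = b <;> by_cases h' : q d = a <;> simp [h, h']

open Classical in
theorem incidence_mulVec {α β : Type*} [Fintype δ] [Fintype β] (p : δ → α) (q : δ → β)
    (f : β → ZMod 2) (a : α) :
    (incidence p q *ᵥ f) a = ∑ d with p d = a, f (q d) := by
  simp only [Matrix.mulVec, dotProduct, incidence, Matrix.of_apply, Finset.sum_mul]
  rw [Finset.sum_comm, Finset.sum_filter]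
  refine Finset.sum_congr rfl fun d _ => ?_
  by_cases h : p d = a <;> simp [h]

open Classical in
theorem sum_edge [Fintype δ] (F : δ → ZMod 2) (d : δ) :
    ∑ x with M.edge x = M.edge d, F x = F d + F (M.rev d) := by
  have : (Finset.univ.filter fun x => M.edge x = M.edge d) = {d, M.rev d} := by
    ext x
    simp only [Finset.mem_filter, Finset.mem_univ, true_and, Finset.mem_insert,
      Finset.mem_singleton]
    rw [eq_comm, M.edge_eq_iff]
  rw [this, Finset.sum_pair (M.rev_ne d).symm]

open Classical in
theorem sum_left_next [Fintype δ] (F : δ → ZMod 2) (R : M.Region) :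
    ∑ x with M.left x = R, F (M.next x) = ∑ x with M.left x = R, F x := by
  refine Finset.sum_equiv M.next ?_ fun _ _ => rfl
  intro x
  simp [M.left_next]

theorem finrank_le_rank_add_one {α β : Type*} [Fintype β] [Fintype α] (A : Matrix α β (ZMod 2))
    (h : ∀ f, A *ᵥ f = 0 → ∀ i j, f i = f j) : Fintype.card β ≤ A.rank + 1 := by
  classical
  have h1 := A.mulVecLin.finrank_range_add_finrank_ker
  have h2 : Module.finrank (ZMod 2) (LinearMap.ker A.mulVecLin) ≤ 1 := by
    have : LinearMap.ker A.mulVecLin ≤ Submodule.span (ZMod 2) {fun _ => (1 : ZMod 2)} := by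
      intro f hf
      have hf := h f (by simpa using hf)
      rw [Submodule.mem_span_singleton]
      rcases isEmpty_or_nonempty β with hβ | ⟨⟨b⟩⟩
      · exact ⟨0, Subsingleton.elim _ _⟩
      · refine ⟨f b, ?_⟩
        ext i
        simpa using hf b i
    refine (Submodule.finrank_mono this).trans ?_
    simpa using finrank_span_le_card (R := ZMod 2) ({fun _ => (1 : ZMod 2)} : Set (β → ZMod 2))
  rw [Module.finrank_fintype_fun_eq_card] at h1
  unfold Matrix.rank
  omega

theorem eq_of_source_closed (hc : M.graph.Connected) {X : Type*} (f : M.Crossing → X)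
    (h : ∀ d, f (M.source d) = f (M.source (M.rev d))) (u v : M.Crossing) : f u = f v := by
  obtain ⟨w⟩ := hc.preconnected u v
  induction w with
  | nil => rfl
  | cons h' _ ih =>
    obtain ⟨-, d, rfl, rfl⟩ := h'
    exact (h d).trans ih

open Classical in
/-- The first cohomology mod 2 of a connected map of Euler characteristic 2 vanishes. -/
theorem exists_potential [Fintype δ] (hc : M.graph.Connected)
    (he : Nat.card M.Crossing + Nat.card M.Region = Nat.card M.Edge + 2)
    (P : δ → ZMod 2)
    (hP : ∀ R, ∑ d with M.left d = R, (P d + P (M.rot d)) = 0) :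
    ∃ f : M.Crossing → ZMod 2, ∀ d,
      f (M.source d) + f (M.source (M.rev d)) = P d + P (M.rev d) := by
  have := Fintype.ofFinite M.Crossing
  have := Fintype.ofFinite M.Edge
  have := Fintype.ofFinite M.Region
  set A := incidence M.edge M.source with hA
  set B := incidence M.left M.edge with hB
  have hrA : Fintype.card M.Crossing ≤ A.rank + 1 := by
    refine finrank_le_rank_add_one A fun f hf => M.eq_of_source_closed hc f fun d => ?_
    have := congrFun hf (M.edge d)
    rw [hA, incidence_mulVec, M.sum_edge] at this
    exact CharTwo.add_eq_zero.1 this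
  -- The dual graph is connected too: a function on regions that agrees across edges is constant
  -- around each crossing, hence descends to crossings.
  have hrB : Fintype.card M.Region ≤ B.rank + 1 := by
    rw [← Matrix.rank_transpose]
    refine finrank_le_rank_add_one _ fun f hf => ?_
    have hrev : ∀ d, f (M.left d) = f (M.left (M.rev d)) := fun d => by
      have := congrFun hf (M.edge d)
      rw [hB, incidence_transpose, incidence_mulVec, M.sum_edge] at this
      exact CharTwo.add_eq_zero.1 this
    have hrot : ∀ d, f (M.left (M.rot d)) = f (M.left d) := fun d => by
      rw [hrev, M.left_rev_rot]
    have hsrc : ∀ d d', M.source d = M.source d' → f (M.left d) = f (M.left d') := fun d d' h =>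
      M.source_induction (p := fun x => f (M.left d) = f (M.left x))
        (fun x hx => hx.trans (hrot x).symm) h rfl
    intro R S
    obtain ⟨d, rfl⟩ := M.left_surjective R
    obtain ⟨d', rfl⟩ := M.left_surjective S
    let g : M.Crossing → ZMod 2 := fun c => f (M.left (Function.surjInv M.source_surjective c))
    have hg : ∀ x, g (M.source x) = f (M.left x) := fun x =>
      hsrc _ _ (Function.surjInv_eq M.source_surjective _)
    rw [← hg, ← hg]
    exact M.eq_of_source_closed hc g (fun x => by rw [hg, hg, hrev]) _ _
  have hle : LinearMap.range A.mulVecLin ≤ LinearMap.ker B.mulVecLin := by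
    rintro _ ⟨f, rfl⟩
    rw [LinearMap.mem_ker]
    ext R
    simp only [Matrix.mulVecLin_apply]
    rw [hB, incidence_mulVec]
    have : ∀ d, (A *ᵥ f) (M.edge d) = f (M.source d) + f (M.source (M.next d)) := fun d => by
      rw [hA, incidence_mulVec, M.sum_edge, M.source_next]
    simp only [this, Finset.sum_add_distrib]
    rw [M.sum_left_next (fun x => f (M.source x)), CharTwo.add_self_eq_zero, Pi.zero_apply]
  -- With V, E, F the numbers of crossings, edges and regions, dim ker B = E - rank B ≤ E - F + 1 =
  -- V - 1 ≤ rank A.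
  have heq : LinearMap.range A.mulVecLin = LinearMap.ker B.mulVecLin := by
    refine Submodule.eq_of_le_of_finrank_le hle ?_
    have h1 := B.mulVecLin.finrank_range_add_finrank_ker
    rw [Module.finrank_fintype_fun_eq_card] at h1
    simp only [Nat.card_eq_fintype_card] at he
    unfold Matrix.rank at hrA hrB
    omega
  -- Since `rev d = rot (next d)`, reindexing by `next` turns the sum of this cochain around a
  -- region into the sum in `hP`.
  have hφ : (incidence M.edge id *ᵥ P) ∈ LinearMap.ker B.mulVecLin := by
    rw [LinearMap.mem_ker]
    ext R
    simp only [Matrix.mulVecLin_apply]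
    rw [hB, incidence_mulVec]
    have : ∀ d, (incidence M.edge id *ᵥ P) (M.edge d) = P d + P (M.rot (M.next d)) := fun d => by
      rw [incidence_mulVec, M.sum_edge, M.rot_next]; rfl
    simp only [this, Finset.sum_add_distrib]
    rw [M.sum_left_next (fun x => P (M.rot x)), ← Finset.sum_add_distrib, hP, Pi.zero_apply]
  rw [← heq] at hφ
  obtain ⟨f, hf⟩ := hφ
  refine ⟨f, fun d => ?_⟩
  have := congrFun hf (M.edge d)
  rw [Matrix.mulVecLin_apply, hA, incidence_mulVec, M.sum_edge, incidence_mulVec,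
    M.sum_edge] at this
  exact this

end SurfaceMap
-- Separating curves and regions visiting a crossing twice
namespace SurfaceMap

variable {δ : Type*} {M : SurfaceMap δ}

theorem eq_of_preconnected_induce {S : Set M.Crossing} (hc : (M.graph.induce S).Preconnected)
    {X : Type*} (f : M.Crossing → X)
    (h : ∀ d, M.source d ∈ S → M.source (M.rev d) ∈ S →
      f (M.source d) = f (M.source (M.rev d)))
    {u v : M.Crossing} (hu : u ∈ S) (hv : v ∈ S) : f u = f v := by
  obtain ⟨w⟩ := hc ⟨u, hu⟩ ⟨v, hv⟩
  suffices ∀ (a b : S), (M.graph.induce S).Walk a b → f a = f b from this _ _ w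
  intro a b w
  induction w with
  | nil => rfl
  | @cons a b _ h' _ ih =>
    obtain ⟨a, ha⟩ := a
    obtain ⟨b, hb⟩ := b
    obtain ⟨-, d, rfl, rfl⟩ := h'
    exact (h d ha hb).trans ih

open Classical in
/-- The indicator of the darts met while turning from `d` (exclusive) to `s` (inclusive). -/
theorem IsFourValent.exists_arc [Finite δ] (h : M.IsFourValent) {d s : δ}
    (hs : M.source s = M.source d) :
    ∃ P : δ → ZMod 2,
      (∀ x, P x + P (M.rot x) = (if x = d then 1 else 0) + if x = s then 1 else 0) ∧
      ∀ x, M.source x ≠ M.source d → P x = 0 := by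
  have key : ∀ a : δ, ∃ P : δ → ZMod 2,
      (∀ x, P x + P (M.rot x) = (if x = a then 1 else 0) + if x = M.rot a then 1 else 0) ∧
      ∀ x, M.source x ≠ M.source a → P x = 0 := by
    intro a
    refine ⟨fun x => if x = M.rot a then 1 else 0, fun x => ?_, fun x hx => ?_⟩
    · simp only [EmbeddingLike.apply_eq_iff_eq]
      exact add_comm _ _
    · refine if_neg ?_
      rintro rfl
      exact hx (M.source_rot a)
  have trans : ∀ {a b : δ}, M.source b = M.source a → (∃ P : δ → ZMod 2,
      (∀ x, P x + P (M.rot x) = (if x = a then 1 else 0) + if x = b then 1 else 0) ∧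
      ∀ x, M.source x ≠ M.source a → P x = 0) → ∃ P : δ → ZMod 2,
      (∀ x, P x + P (M.rot x) = (if x = a then 1 else 0) + if x = M.rot b then 1 else 0) ∧
      ∀ x, M.source x ≠ M.source a → P x = 0 := by
    rintro a b hb ⟨P, hP, hP'⟩
    obtain ⟨Q, hQ, hQ'⟩ := key b
    refine ⟨P + Q, fun x => ?_, fun x hx => ?_⟩
    · simp only [Pi.add_apply]
      rw [add_add_add_comm, hP, hQ, add_assoc, ← add_assoc (if x = b then _ else _),
        CharTwo.add_self_eq_zero, zero_add]
    · simp [hP' x hx, hQ' x (hb ▸ hx)]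
  rcases h.eq_of_source_eq hs with rfl | rfl | rfl | rfl
  · exact ⟨0, fun x => by simp [CharTwo.add_self_eq_zero], fun _ _ => rfl⟩
  · exact key d
  · exact trans (M.source_rot d) (key d)
  · exact trans ((M.source_rot _).trans (M.source_rot d)) (trans (M.source_rot d) (key d))

theorem zmod_two_ne_iff {a b m : ZMod 2} : (a + b = 0 → (a ≠ m ↔ b ≠ m)) ∧
    (a + b = 1 → (a ≠ m ↔ b = m)) := by
  revert a b m; decide

theorem rev_ne_rot [Finite δ] (hmin : ∀ R, 3 ≤ M.sides R) (d : δ) : M.rev d ≠ M.rot d :=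
  fun h => M.next_ne_self hmin d (M.rot.injective (by rw [M.rot_next, h]))

theorem rot_rev_ne [Finite δ] (hmin : ∀ R, 3 ≤ M.sides R) (d : δ) : M.rot (M.rev d) ≠ d :=
  fun h => rev_ne_rot hmin (M.rev d) (by rw [M.rev_rev, h])

/-- A loop whose two darts are neighbours in the rotation would bound a monogon. -/
theorem IsFourValent.rev_eq [Finite δ] (h : M.IsFourValent) (hmin : ∀ R, 3 ≤ M.sides R) {d : δ}
    (hd : M.source (M.rev d) = M.source d) : M.rev d = M.rot (M.rot d) := by
  rcases h.eq_of_source_eq hd with h1 | h1 | h1 | h1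
  · exact absurd h1 (M.rev_ne d)
  · exact absurd h1 (rev_ne_rot hmin d)
  · exact h1
  · exact absurd (by rw [h1, h.rot_four]) (rot_rev_ne hmin d)

open Classical in
theorem sum_left_ite [Fintype δ] (a : δ) (R : M.Region) :
    ∑ d with M.left d = R, (if d = a then (1 : ZMod 2) else 0) = if M.left a = R then 1 else 0 := by
  simp [Finset.sum_ite_eq']

variable [Finite δ]

/-- In a 2-connected spherical map without monogons, the boundary of a region passes through each
crossing at most once. -/
theorem IsFourValent.region_simple (h : M.IsFourValent) (hmin : ∀ R, 3 ≤ M.sides R)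
    (hc : M.graph.Connected)
    (he : Nat.card M.Crossing + Nat.card M.Region = Nat.card M.Edge + 2)
    (h2 : ∀ c, (M.graph.induce ({c} : Set M.Crossing)ᶜ).Connected)
    {d s : δ} (hs : M.source s = M.source d) (hl : M.left s = M.left d) : s = d := by
  classical
  have := Fintype.ofFinite δ
  by_contra hne
  obtain ⟨P, hP, hP0⟩ := h.exists_arc hs
  -- The curve leaves the crossing by corner `d` and returns by corner `s`, both in one region, so
  -- the parity condition holds.
  obtain ⟨f, hf⟩ := M.exists_potential hc he P fun R => by
    simp only [hP, Finset.sum_add_distrib, sum_left_ite, hl, CharTwo.add_self_eq_zero]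
  obtain ⟨⟨w, hw⟩⟩ := (h2 (M.source d)).nonempty
  -- As `f` is constant off the crossing, `m` is the value of `P` on every dart there that is not a
  -- loop.
  set m := f (M.source d) + f w with hm
  have hnl : ∀ x, M.source x = M.source d → P x ≠ m → M.source (M.rev x) = M.source d := by
    intro x hx hxm
    by_contra hr
    apply hxm
    have h1 := hf x
    rw [hP0 _ hr, add_zero, hx] at h1
    rw [← h1, hm]
    congr 1
    refine eq_of_preconnected_induce (h2 (M.source d)).preconnected f (fun y hy hy' => ?_) hr hw
    have := hf y
    rwa [hP0 _ hy, hP0 _ hy', add_zero, CharTwo.add_eq_zero] at this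
  have hstep : ∀ x, M.source x = M.source d → P x ≠ m → P (M.rot (M.rot x)) ≠ m := by
    intro x hx hxm
    have hr := hnl x hx hxm
    rw [← h.rev_eq hmin (hr.trans hx.symm)]
    have h1 := hf x
    rw [hr, hx, CharTwo.add_self_eq_zero, eq_comm, CharTwo.add_eq_zero] at h1
    rwa [← h1]
  have hd : P d + P (M.rot d) = 1 := by simp [hP, Ne.symm hne]
  obtain ⟨z, hz, hzm⟩ : ∃ z, M.source z = M.source d ∧ P z ≠ m := by
    by_cases h1 : P d = m
    · exact ⟨M.rot d, M.source_rot d, fun h2 =>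
        (zmod_two_ne_iff.2 hd).2 h2 h1⟩
    · exact ⟨d, rfl, h1⟩
  have hz1 := M.source_rot z
  have hz2 := M.source_rot (M.rot z)
  have hz' := hstep z hz hzm
  -- Loops join opposite darts, so `P` agrees on opposite darts. Either it alternates and changes at
  -- all four corners, or it is constant; but it changes at exactly the two corners `d` and `s`.
  by_cases h1 : P (M.rot z) = m
  · have h3 : P (M.rot (M.rot (M.rot z))) = m := by
      by_contra h3
      have := hstep _ (by rw [M.source_rot, hz2, hz1, hz]) h3
      rw [h.rot_four] at this
      exact this h1
    have hch : ∀ x, (P x ≠ m ↔ P (M.rot x) = m) → x = d ∨ x = s := by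
      intro x hx
      by_contra hxx
      push Not at hxx
      have := hP x
      simp only [hxx.1, hxx.2, if_false, add_zero] at this
      have := (zmod_two_ne_iff (m := m)).1 this
      tauto
    have a0 := hch z (by tauto)
    have a1 := hch (M.rot z) (by tauto)
    have a2 := hch (M.rot (M.rot z)) (by tauto)
    have := h.rot_ne z
    have := h.rot_two_ne z
    have := h.rot_ne (M.rot z)
    grind
  · have h3 := hstep _ (by rw [M.source_rot, hz]) h1
    have hall : P d ≠ m ∧ P (M.rot d) ≠ m := by
      rcases h.eq_of_source_eq hz.symm with rfl | rfl | rfl | rfl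
      · exact ⟨hzm, h1⟩
      · exact ⟨h1, hz'⟩
      · exact ⟨hz', h3⟩
      · exact ⟨h3, by rwa [h.rot_four]⟩
    exact hall.2 ((zmod_two_ne_iff.2 hd).1 hall.1)

/-! ### Regions meeting at two crossings -/

variable (M) in
/-- Each region passes through each crossing at most once. -/
def RegionsSimple : Prop :=
  ∀ ⦃d s⦄, M.source s = M.source d → M.left s = M.left d → s = d

variable (M) in
/-- Two distinct regions at a crossing `u` that meet again in another crossing are the two sides
of an edge from `u` to that crossing. -/
def RegionsMeetOnce : Prop :=
  ∀ ⦃d s d' s'⦄, M.source s = M.source d → s ≠ d → M.source s' = M.source d' →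
    M.source d ≠ M.source d' → M.left d = M.left d' → M.left s = M.left s' →
    (s = M.rot d ∧ M.source (M.rev s) = M.source d') ∨
    (d = M.rot s ∧ M.source (M.rev d) = M.source d')

theorem RegionsSimple.source_rev_ne (hS : M.RegionsSimple) (hmin : ∀ R, 3 ≤ M.sides R) (d : δ) :
    M.source (M.rev d) ≠ M.source d := fun h =>
  M.next_ne_self hmin d (hS (by rw [M.source_next, h]) (M.left_next d))

/-- The region between the two darts would visit their common end at a single corner, and so be a
bigon. -/
theorem RegionsSimple.not_parallel (hS : M.RegionsSimple) (hmin : ∀ R, 3 ≤ M.sides R) (d : δ) :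
    M.source (M.rev (M.rot d)) ≠ M.source (M.rev d) := fun h =>
  M.next_next_ne_self hmin d (by
    have : M.rev (M.rot d) = M.next d :=
      hS (by rw [h, M.source_next]) (by rw [M.left_rev_rot, M.left_next])
    rw [← this, M.next_rev_rot])

theorem RegionsSimple.meetOnce_of_connected (hS : M.RegionsSimple) (h : M.IsFourValent)
    (hmin : ∀ R, 3 ≤ M.sides R) (hc : M.graph.Connected)
    (he : Nat.card M.Crossing + Nat.card M.Region = Nat.card M.Edge + 2)
    (h3 : ∀ u v, u ≠ v → (M.graph.induce ({u, v} : Set M.Crossing)ᶜ).Connected) :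
    M.RegionsMeetOnce := by
  classical
  have := Fintype.ofFinite δ
  intro d s d' s' hs hne hs' huv hld hls
  obtain ⟨P, hP, hP0⟩ := h.exists_arc hs
  obtain ⟨P', hP', hP0'⟩ := h.exists_arc hs'
  -- The curve passes through both regions and crosses from one to the other at each of the two
  -- crossings.
  obtain ⟨f, hf⟩ := M.exists_potential hc he (P + P') fun R => by
    simp only [Pi.add_apply]
    rw [Finset.sum_congr rfl fun x _ => (add_add_add_comm _ _ _ _).trans
      (congrArg₂ (· + ·) (hP x) (hP' x))]
    simp only [Finset.sum_add_distrib, sum_left_ite, hld, hls, CharTwo.add_self_eq_zero]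
  obtain ⟨⟨w, hw⟩⟩ := (h3 _ _ huv).nonempty
  have hz : ∀ {x}, M.source x ∈ ({M.source d, M.source d'} : Set M.Crossing)ᶜ →
      (P + P') x = 0 := by
    intro x hx
    simp only [Set.mem_compl_iff, Set.mem_insert_iff, Set.mem_singleton_iff, not_or] at hx
    simp [hP0 x hx.1, hP0' x hx.2]
  set m := f (M.source d) + f w with hm
  have hQ : ∀ x, M.source x = M.source d → P x ≠ m → M.source (M.rev x) = M.source d' := by
    intro x hx hxm
    by_contra hr
    have hr' : M.source (M.rev x) ∈ ({M.source d, M.source d'} : Set M.Crossing)ᶜ := by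
      simp only [Set.mem_compl_iff, Set.mem_insert_iff, Set.mem_singleton_iff, not_or]
      exact ⟨hx ▸ hS.source_rev_ne hmin x, hr⟩
    apply hxm
    have h1 := hf x
    rw [hz hr', add_zero, hx, Pi.add_apply, hP0' x (hx ▸ huv), add_zero] at h1
    rw [← h1, hm]
    congr 1
    refine eq_of_preconnected_induce (h3 _ _ huv).preconnected f (fun y hy hy' => ?_) hr' hw
    have := hf y
    rwa [hz hy, hz hy', add_zero, CharTwo.add_eq_zero] at this
  have hQ2 : ∀ x, M.source x = M.source d → P x ≠ m → P (M.rot x) = m := by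
    intro x hx hxm
    by_contra hr
    exact hS.not_parallel hmin x
      ((hQ _ (by rw [M.source_rot, hx]) hr).trans (hQ x hx hxm).symm)
  have hd : P d + P (M.rot d) = 1 := by simp [hP, Ne.symm hne]
  obtain ⟨z, hzd, hzm⟩ : ∃ z, M.source z = M.source d ∧ P z ≠ m := by
    by_cases h1 : P d = m
    · exact ⟨M.rot d, M.source_rot d, fun h2 =>
        (zmod_two_ne_iff.2 hd).2 h2 h1⟩
    · exact ⟨d, rfl, h1⟩
  have hch : ∀ x, (P x ≠ m ↔ P (M.rot x) = m) → x = d ∨ x = s := by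
    intro x hx
    by_contra hxx
    push Not at hxx
    have := hP x
    simp only [hxx.1, hxx.2, if_false, add_zero] at this
    have := (zmod_two_ne_iff (m := m)).1 this
    tauto
  -- Both rotation neighbours of `z` have value `m`, so `P` changes at the corners on either side of
  -- `z`; these must be `d` and `s`.
  have hz1 := hQ2 z hzd hzm
  have hz3 : P (M.rot (M.rot (M.rot z))) = m := by
    by_contra h3
    have := hQ2 _ (by rw [M.source_rot, M.source_rot, M.source_rot, hzd]) h3
    rw [h.rot_four] at this
    exact hzm this
  have a0 := hch z (by tauto)
  have a3 := hch (M.rot (M.rot (M.rot z))) (by rw [h.rot_four]; tauto)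
  have hzv := hQ z hzd hzm
  have h4 := h.rot_four z
  have := h.rot_three_ne z
  rcases a0 with rfl | rfl <;> rcases a3 with a3 | a3
  · exact absurd a3 this
  · exact Or.inr ⟨by rw [← a3, h4], hzv⟩
  · exact Or.inl ⟨by rw [← a3, h4], hzv⟩
  · exact absurd a3 this

end SurfaceMap

/-! ### Closed walks and circles -/

section Circle

variable {α β W : Type*} {G : Graph α β} {σ : Equiv.Perm W} {a : W → α} {b : W → β}

/-- A closed walk without repeated vertices, of length at least three, that exhausts a graph. -/
theorem isCircle_of_sameCycle [Finite W] [Nonempty W] (hσ : ∀ w w', σ.SameCycle w w')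
    (h2 : ∀ w, σ (σ w) ≠ w) (ha : Function.Injective a)
    (hl : ∀ w, G.IsLink (b w) (a w) (a (σ w)))
    (hV : G.vertexSet ⊆ Set.range a) (hE : G.edgeSet ⊆ Set.range b) : IsCircle G := by
  obtain ⟨w₀⟩ := ‹Nonempty W›
  -- A repeated edge has the same ends: in the same order the steps coincide, in the opposite order
  -- `σ` has a cycle of length at most two.
  have hb : Function.Injective b := by
    intro w w' h
    have h' := hl w'
    rw [← h] at h'
    rcases (hl w).eq_and_eq_or_eq_and_eq h' with ⟨h1, -⟩ | ⟨h1, h3⟩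
    · exact ha h1
    · exact absurd (by rw [← ha h1, ha h3]) (h2 w')
  have hVa : ∀ w, a w ∈ G.vertexSet := fun w => (hl w).left_mem
  have hEb : ∀ w, b w ∈ G.edgeSet := fun w => (hl w).edge_mem
  set n := Function.minimalPeriod (σ • ·) w₀ with hn
  have hpos : 0 < n := Function.minimalPeriod_pos_of_mem_periodicPts
    (Function.Injective.mem_periodicPts σ.injective w₀)
  let e : ZMod n → W := fun i => ((MulAction.orbitZPowersEquiv σ w₀).symm i : W)
  have he : ∀ k : ℤ, e k = (σ ^ k) w₀ := by
    intro k
    exact congrArg Subtype.val (MulAction.orbitZPowersEquiv_symm_apply' σ w₀ k)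
  have hinj : Function.Injective e :=
    Subtype.val_injective.comp (MulAction.orbitZPowersEquiv σ w₀).symm.injective
  have hsurj : Function.Surjective e := by
    intro w
    obtain ⟨k, hk⟩ := hσ w₀ w
    exact ⟨k, (he k).trans hk⟩
  have hsucc : ∀ i, e (i + 1) = σ (e i) := by
    intro i
    obtain ⟨k, rfl⟩ := ZMod.intCast_surjective i
    have : ((k : ZMod n) + 1) = ((k + 1 : ℤ) : ZMod n) := by push_cast; rfl
    rw [this, he, he, add_comm, zpow_add, zpow_one]
    rfl
  refine ⟨n, hpos, a ∘ e, b ∘ e, ha.comp hinj, hb.comp hinj, ?_, ?_, fun i => ?_⟩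
  · rw [hsurj.range_comp]
    exact (Set.range_subset_iff.2 hVa).antisymm hV
  · rw [hsurj.range_comp]
    exact (Set.range_subset_iff.2 hEb).antisymm hE
  · simp only [Function.comp_apply, hsucc]
    exact hl _

/-- A closed walk in a circle that neither backtracks nor traverses an edge twice in the same
direction has no repeated vertices. -/
theorem IsCircle.injective_of_walk [Finite W] (hG : IsCircle G)
    (hσ : ∀ w w', σ.SameCycle w w')
    (hl : ∀ w, G.IsLink (b w) (a w) (a (σ w))) (hb : ∀ w, b (σ w) ≠ b w)
    (hab : ∀ w w', b w = b w' → a w = a w' → w = w') : Function.Injective a := by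
  obtain ⟨n, -, x, y, hx, hy, hV, hE, hxy⟩ := hG
  have hp : ∀ w, ∃ i, x i = a w := fun w => by
    have : a w ∈ Set.range x := hV ▸ (hl w).left_mem
    exact this
  choose p hp using hp
  -- Forward or backward is read off the edge as well as the positions, which alone do not determine
  -- it when `n ≤ 2`.
  have hstep : ∀ w, (b w = y (p w) ∧ p (σ w) = p w + 1) ∨
      (b w = y (p (σ w)) ∧ p w = p (σ w) + 1) := by
    intro w
    have : b w ∈ Set.range y := hE ▸ (hl w).edge_mem
    obtain ⟨j, hj⟩ := this
    have h1 := hxy j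
    rw [hj] at h1
    rcases h1.eq_and_eq_or_eq_and_eq (hl w) with ⟨h2, h3⟩ | ⟨h2, h3⟩
    · rw [← hp] at h2 h3
      rw [← hx h2, ← hx h3]
      exact Or.inl ⟨hj.symm, rfl⟩
    · rw [← hp] at h2 h3
      rw [← hx h2, ← hx h3]
      exact Or.inr ⟨hj.symm, rfl⟩
  have propagate : ∀ q : W → Prop, (∀ w, q w → q (σ w)) → ∀ w w', q w → q w' := by
    intro q hq w w' hw
    obtain ⟨i, rfl⟩ := (hσ w w').exists_nat_pow_eq
    induction i with
    | zero => simpa using hw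
    | succ k ih => rw [pow_succ']; exact hq _ (ih)
  intro w w' hww
  have hpw : p w = p w' := hx (by rw [hp, hp, hww])
  by_cases hf : b w = y (p w) ∧ p (σ w) = p w + 1
  · have := propagate (fun w => b w = y (p w) ∧ p (σ w) = p w + 1) (by
      rintro z ⟨h1, h2⟩
      refine (hstep (σ z)).resolve_right ?_
      rintro ⟨h3, h4⟩
      apply hb z
      rw [h3, h1]
      congr 1
      exact add_right_cancel (h4.symm.trans h2)) w w' hf
    exact hab _ _ (by rw [hf.1, this.1, hpw]) hww
  · have hall := propagate (fun w => b w = y (p (σ w)) ∧ p w = p (σ w) + 1) (by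
      rintro z ⟨h1, h2⟩
      refine (hstep (σ z)).resolve_left ?_
      rintro ⟨h3, h4⟩
      exact hb z (h3.trans h1.symm)) w
    have hw := (hstep w).resolve_left hf
    -- When the walk runs backward, the position of `w` determines the edge and the start of the
    -- step into `w`, so predecessors are compared.
    obtain ⟨z, rfl⟩ := σ.surjective w
    obtain ⟨z', rfl⟩ := σ.surjective w'
    have h1 := hall z hw
    have h2 := hall z' hw
    congr 1
    refine hab _ _ (by rw [h1.1, h2.1, hpw]) ?_
    rw [← hp, ← hp, h1.2, h2.2, hpw]

end Circle

/-! ### The walk around the link of a region -/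

namespace SurfaceMap

variable {δ : Type*} {M : SurfaceMap δ}

variable (M) in
/-- The index set of the closed walk around the link of `R`: two steps for each corner of `R`. -/
abbrev LinkStep (R : M.Region) : Type _ := {d // M.left d = R} × Bool

variable (M) in
/-- The cyclic successor of a step of the walk around the link of `R`. -/
def linkSucc (R : M.Region) : Equiv.Perm (M.LinkStep R) where
  toFun w := if w.2 then (⟨M.next w.1, (M.left_next _).trans w.1.2⟩, false) else (w.1, true)
  invFun w := if w.2 then (w.1, false) else
    (⟨M.next.symm w.1, by rw [← M.left_next, Equiv.apply_symm_apply]; exact w.1.2⟩, true)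
  left_inv := by rintro ⟨d, _ | _⟩ <;> simp
  right_inv := by rintro ⟨d, _ | _⟩ <;> simp

variable (M) in
/-- The dart crossed by a step of the walk around the link of `R`, from right to left. -/
def linkDart {R : M.Region} (w : M.LinkStep R) : δ :=
  if w.2 then M.rot (M.rot (M.rot w.1)) else M.rot (M.rot w.1)

variable (M) in
/-- The region from which a step of the walk around the link of `R` starts. -/
def linkRegion {R : M.Region} (w : M.LinkStep R) : M.Region :=
  if w.2 then M.left (M.rot (M.rot w.1)) else M.left (M.rot w.1)

theorem linkRegion_eq {R : M.Region} (w : M.LinkStep R) :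
    M.linkRegion w = M.left (M.rev (M.linkDart w)) := by
  rcases w with ⟨d, _ | _⟩ <;> simp [linkRegion, linkDart, M.left_rev_rot]

/-- Both corners lie in the region to the right of `d`, one at each end. This is what closes up the
link walk from one corner of the region to the next. -/
theorem IsFourValent.left_rot_three (h : M.IsFourValent) (d : δ) :
    M.left (M.rot (M.rot (M.rot d))) = M.left (M.rot (M.next d)) := by
  rw [M.rot_next, ← M.left_next (M.rev d)]
  congr 1
  apply M.rot.injective
  rw [M.rot_next, M.rev_rev, h.rot_four]

theorem IsFourValent.linkRegion_linkSucc (h : M.IsFourValent) {R : M.Region} (w : M.LinkStep R) :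
    M.linkRegion (M.linkSucc R w) = M.left (M.linkDart w) := by
  rcases w with ⟨d, _ | _⟩
  · simp [linkRegion, linkDart, linkSucc]
  · simp only [linkRegion, linkDart, linkSucc, Equiv.coe_fn_mk, if_true, Bool.false_eq_true,
      if_false, h.left_rot_three]

theorem RegionsSimple.left_rot_ne (hS : M.RegionsSimple) (h : M.IsFourValent) (d : δ) :
    M.left (M.rot d) ≠ M.left d :=
  fun hd => h.rot_ne d (hS (M.source_rot d) hd)

theorem RegionsSimple.left_rot_two_ne (hS : M.RegionsSimple) (h : M.IsFourValent) (d : δ) :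
    M.left (M.rot (M.rot d)) ≠ M.left d :=
  fun hd => h.rot_two_ne d (hS ((M.source_rot _).trans (M.source_rot d)) hd)

theorem RegionsSimple.left_rot_three_ne (hS : M.RegionsSimple) (h : M.IsFourValent) (d : δ) :
    M.left (M.rot (M.rot (M.rot d))) ≠ M.left d :=
  fun hd => h.rot_three_ne d
    (hS ((M.source_rot _).trans ((M.source_rot _).trans (M.source_rot d))) hd)

theorem RegionsSimple.left_rev_ne (hS : M.RegionsSimple) (h : M.IsFourValent) (d : δ) :
    M.left (M.rev d) ≠ M.left d := by
  obtain ⟨d, rfl⟩ := M.rot.surjective d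
  rw [M.left_rev_rot]
  exact (hS.left_rot_ne h d).symm

theorem RegionsSimple.isLink_boundary (hS : M.RegionsSimple) (h : M.IsFourValent) {R : M.Region}
    (w : M.LinkStep R) : (M.boundary R).IsLink (M.edge (M.linkDart w)) (M.linkRegion w)
      (M.linkRegion (M.linkSucc R w)) := by
  have hl : M.dual.IsLink (M.edge (M.linkDart w)) (M.linkRegion w)
      (M.linkRegion (M.linkSucc R w)) :=
    ⟨M.rev (M.linkDart w), M.edge_rev _, (linkRegion_eq w).symm, by
      rw [M.rev_rev, h.linkRegion_linkSucc]⟩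
  refine ⟨hl, ?_, M.source w.1, ⟨w.1, rfl, w.1.2⟩, M.linkDart w, ?_, rfl⟩
  · rintro ⟨T, hT⟩
    have hR : R = M.linkRegion w ∨ R = M.linkRegion (M.linkSucc R w) := by
      rcases hl.eq_and_eq_or_eq_and_eq hT with h | h
      · exact Or.inl h.1.symm
      · exact Or.inr h.2.symm
    rw [h.linkRegion_linkSucc] at hR
    obtain ⟨⟨d, rfl⟩, _ | _⟩ := w
    · rcases hR with hR | hR
      · exact hS.left_rot_ne h d (by simpa [linkRegion] using hR.symm)
      · exact hS.left_rot_two_ne h d (by simpa [linkDart] using hR.symm)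
    · rcases hR with hR | hR
      · exact hS.left_rot_two_ne h d (by simpa [linkRegion] using hR.symm)
      · exact hS.left_rot_three_ne h d (by simpa [linkDart] using hR.symm)
  · rcases w with ⟨d, _ | _⟩ <;> simp [linkDart, M.source_rot]

theorem left_rot_mem_range {R : M.Region} {d : δ} (hd : M.left d = R) :
    M.left (M.rot d) ∈ Set.range (M.linkRegion (R := R)) := ⟨(⟨d, hd⟩, false), by simp [linkRegion]⟩

theorem RegionsSimple.linkDart_injective (hS : M.RegionsSimple) (h : M.IsFourValent)
    (R : M.Region) : Function.Injective (M.linkDart (R := R)) := by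
  have key : ∀ d d' : δ, M.left d = M.left d' →
      M.rot (M.rot d) ≠ M.rot (M.rot (M.rot d')) := by
    intro d d' hl hd
    have := M.rot.injective (M.rot.injective hd)
    rw [this] at hl
    exact hS.left_rot_ne h d' hl
  rintro ⟨⟨d, hd⟩, _ | _⟩ ⟨⟨d', hd'⟩, _ | _⟩ hww
  · simpa [linkDart] using hww
  · exact absurd (by simpa [linkDart] using hww) (key d d' (hd.trans hd'.symm))
  · exact absurd (by simpa [linkDart] using hww.symm) (key d' d (hd'.trans hd.symm))
  · simpa [linkDart] using hww

variable [Finite δ]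

theorem sameCycle_linkSucc {R : M.Region} (w w' : M.LinkStep R) :
    (M.linkSucc R).SameCycle w w' := by
  have hT : ∀ d, (M.linkSucc R).SameCycle (d, false) (d, true) := fun d =>
    ⟨1, by simp [linkSucc]⟩
  have hF : ∀ d : {d // M.left d = R}, (M.linkSucc R).SameCycle (d, false)
      (⟨M.next d, (M.left_next _).trans d.2⟩, false) := fun d =>
    (hT d).trans ⟨1, by simp [linkSucc]⟩
  suffices ∀ d d' : {d // M.left d = R}, (M.linkSucc R).SameCycle (d, false) (d', false) by
    rcases w with ⟨d, _ | _⟩ <;> rcases w' with ⟨d', _ | _⟩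
    · exact this d d'
    · exact (this d d').trans (hT d')
    · exact (hT d).symm.trans (this d d')
    · exact (hT d).symm.trans ((this d d').trans (hT d'))
  rintro ⟨d, hd⟩ ⟨d', hd'⟩
  refine M.left_induction (p := fun x => ∀ hx : M.left x = R,
    (M.linkSucc R).SameCycle (⟨d, hd⟩, false) (⟨x, hx⟩, false)) ?_ (hd.trans hd'.symm)
    (fun _ => .refl _ _) hd'
  intro x hx hx'
  exact (hx ((M.left_next x).symm.trans hx')).trans (hF ⟨x, _⟩)

theorem linkSucc_linkSucc_ne (hmin : ∀ R, 3 ≤ M.sides R) {R : M.Region} (w : M.LinkStep R) :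
    M.linkSucc R (M.linkSucc R w) ≠ w := by
  rcases w with ⟨⟨d, hd⟩, _ | _⟩ <;> simp [linkSucc, M.next_ne_self hmin]

theorem IsFourValent.vertexSet_boundary_subset (h : M.IsFourValent) (R : M.Region) :
    (M.boundary R).vertexSet ⊆ Set.range (M.linkRegion (R := R)) := by
  rintro _ ⟨hne, c, ⟨d, rfl, rfl⟩, s, hs, rfl⟩
  rcases h.eq_of_source_eq hs with rfl | rfl | rfl | rfl
  · exact absurd rfl hne
  · exact left_rot_mem_range rfl
  · exact ⟨(⟨d, rfl⟩, true), by simp [linkRegion]⟩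
  · rw [h.left_rot_three]
    exact left_rot_mem_range (M.left_next d)

theorem IsFourValent.edgeSet_boundary_subset (h : M.IsFourValent) (R : M.Region) :
    (M.boundary R).edgeSet ⊆ Set.range fun w : M.LinkStep R => M.edge (M.linkDart w) := by
  intro e he
  rw [Graph.edge_mem_iff_exists_isLink] at he
  obtain ⟨S, T, -, hR, c, ⟨d, rfl, rfl⟩, s, hs, rfl⟩ := he
  rcases h.eq_of_source_eq hs with rfl | rfl | rfl | rfl
  · exact absurd ⟨_, s, rfl, rfl, rfl⟩ hR
  · exact absurd ⟨_, M.rev (M.rot d), M.edge_rev _, M.left_rev_rot d, rfl⟩ hR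
  · exact ⟨(⟨d, rfl⟩, false), by simp [linkDart]⟩
  · exact ⟨(⟨d, rfl⟩, true), by simp [linkDart]⟩

/-- Backtracking would force a monogon, a loop or a bigon. A repeated edge with the same starting
region is crossed by the same dart, because the two sides of an edge are distinct regions. -/
theorem RegionsSimple.linkRegion_injective_of_isCircle (hS : M.RegionsSimple)
    (h : M.IsFourValent) (hmin : ∀ R, 3 ≤ M.sides R) {R : M.Region}
    (hR : IsCircle (M.boundary R)) : Function.Injective (M.linkRegion (R := R)) := by
  refine hR.injective_of_walk sameCycle_linkSucc (hS.isLink_boundary h) ?_ ?_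
  · rintro ⟨⟨d, hd⟩, _ | _⟩ heq
    · simp only [linkSucc, linkDart, Equiv.coe_fn_mk, Bool.false_eq_true, if_false, if_true] at heq
      rcases (M.edge_eq_iff _ _).1 heq with h1 | h1
      · exact h.rot_ne _ h1.symm
      · exact rot_rev_ne hmin _ (congrArg M.rot h1).symm
    · simp only [linkSucc, linkDart, Equiv.coe_fn_mk, Bool.false_eq_true, if_false, if_true,
        M.rot_next] at heq
      rcases (M.edge_eq_iff _ _).1 heq with h1 | h1
      · have : M.source (M.rev d) = M.source d := by
          rw [← M.source_rot (M.rev d), ← h1]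
          simp only [M.source_rot]
        exact hS.source_rev_ne hmin d this
      · have h2 : M.next (M.rev d) = M.rot (M.rot (M.rot d)) := by
          apply M.rot.injective
          rw [M.rot_next, M.rev_rev, h.rot_four]
        refine M.next_next_ne_self hmin (M.rev d) ?_
        rw [h2, h1, M.next_rev_rot]
  · intro w w' he ha
    rcases (M.edge_eq_iff _ _).1 he with h1 | h1
    · exact hS.linkDart_injective h R h1.symm
    · rw [linkRegion_eq, linkRegion_eq, h1, M.rev_rev] at ha
      exact absurd ha (hS.left_rev_ne h _)

theorem RegionsSimple.isCircle_of_linkRegion_injective (hS : M.RegionsSimple)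
    (h : M.IsFourValent) (hmin : ∀ R, 3 ≤ M.sides R) {R : M.Region}
    (hR : Function.Injective (M.linkRegion (R := R))) : IsCircle (M.boundary R) := by
  obtain ⟨d, hd⟩ := M.left_surjective R
  have : Nonempty (M.LinkStep R) := ⟨(⟨d, hd⟩, false)⟩
  exact isCircle_of_sameCycle sameCycle_linkSucc (linkSucc_linkSucc_ne hmin) hR
    (hS.isLink_boundary h) (h.vertexSet_boundary_subset R) (h.edgeSet_boundary_subset R)

theorem RegionsMeetOnce.linkRegion_injective (hN : M.RegionsMeetOnce) (hS : M.RegionsSimple)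
    (h : M.IsFourValent) (hmin : ∀ R, 3 ≤ M.sides R) (R : M.Region) :
    Function.Injective (M.linkRegion (R := R)) := by
  have src2 : ∀ d, M.source (M.rot (M.rot d)) = M.source d := fun d =>
    (M.source_rot _).trans (M.source_rot d)
  -- Opposite regions at a crossing have no common edge there, so they cannot meet at a second
  -- crossing.
  have opp : ∀ d d' s', M.left d = M.left d' → M.source s' = M.source d' →
      M.left (M.rot (M.rot d)) = M.left s' → d = d' := by
    intro d d' s' hl hs' hl'
    by_contra hne
    rcases hN (src2 d) (h.rot_two_ne d) hs' (fun hs => hne (hS hs hl)) hl hl' with h1 | h1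
    · exact h.rot_ne _ h1.1
    · exact h.rot_three_ne d h1.1.symm
  -- Applied in both orders, this makes `d` and `d'` the two sides of a bigon.
  have adj : ∀ d d', M.left d = M.left d' → d ≠ d' → M.left (M.rot d) = M.left (M.rot d') →
      M.next d' = d := by
    intro d d' hl hne hl'
    rcases hN (M.source_rot d) (h.rot_ne d) (M.source_rot d') (fun hs => hne (hS hs hl)) hl hl'
      with h1 | h1
    · rw [← hS h1.2 ((M.left_rev_rot d).trans hl), M.next_rev_rot]
    · exact absurd h1.1.symm (h.rot_two_ne d)
  rintro ⟨⟨d, hd⟩, _ | _⟩ ⟨⟨d', hd'⟩, _ | _⟩ hww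
  · simp only [linkRegion, Bool.false_eq_true, if_false] at hww
    by_cases hne : d = d'
    · simp [hne]
    · have h1 := adj d d' (hd.trans hd'.symm) hne hww
      have h2 := adj d' d (hd'.trans hd.symm) (Ne.symm hne) hww.symm
      exact absurd (by rw [h2, h1]) (M.next_next_ne_self hmin d)
  · simp only [linkRegion, Bool.false_eq_true, if_false, if_true] at hww
    have := opp d' d _ (hd'.trans hd.symm) (M.source_rot d) hww.symm
    subst this
    exact absurd hww.symm (hS.left_rot_ne h _)
  · simp only [linkRegion, Bool.false_eq_true, if_false, if_true] at hww
    have := opp d d' _ (hd.trans hd'.symm) (M.source_rot d') hww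
    subst this
    exact absurd hww (hS.left_rot_ne h _)
  · simp only [linkRegion, if_true] at hww
    have := opp d d' _ (hd.trans hd'.symm) (src2 d') hww
    simp [this]

/-- Each meeting of R with another region at a crossing gives a step of the link walk. Injectivity
makes the steps from two crossings coincide, and distinct crossings share a step only when they are
the ends of an edge between the two regions. -/
theorem RegionsSimple.meetOnce_of_linkRegion_injective (hS : M.RegionsSimple)
    (h : M.IsFourValent) (hR : ∀ R, Function.Injective (M.linkRegion (R := R))) :
    M.RegionsMeetOnce := by
  /- the steps of the link walk that start from the region of a given corner -/
  have step : ∀ d s : δ, M.source s = M.source d → s ≠ d →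
      (s = M.rot d ∧ M.linkRegion (R := M.left d) (⟨d, rfl⟩, false) = M.left s) ∨
      (M.linkRegion (R := M.left d) (⟨d, rfl⟩, true) = M.left s) ∨
      (d = M.rot s ∧
        M.linkRegion (R := M.left d) (⟨M.next d, M.left_next d⟩, false) = M.left s) := by
    intro d s hs hne
    rcases h.eq_of_source_eq hs with rfl | rfl | rfl | rfl
    · exact absurd rfl hne
    · exact Or.inl ⟨rfl, by simp [linkRegion]⟩
    · exact Or.inr (Or.inl (by simp [linkRegion]))
    · exact Or.inr (Or.inr ⟨(h.rot_four d).symm, by simp [linkRegion, h.left_rot_three]⟩)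
  intro d s d' s' hs hne hs' huv hld hls
  have hne' : s' ≠ d' := by
    rintro rfl
    exact hne (hS hs (hls.trans hld.symm))
  have hdd : d ≠ d' := fun hd => huv (by rw [hd])
  have h1 := step d s hs hne
  have h2 := step d' s' hs' hne'
  rw [← hls] at h2
  have cast : ∀ {R} (hR' : M.left d' = R) (x : δ) (hx : M.left x = M.left d') (b : Bool),
      M.linkRegion (R := M.left d') (⟨x, hx⟩, b) =
        M.linkRegion (R := R) (⟨x, hx.trans hR'⟩, b) := by
    rintro R rfl x hx b; rfl
  simp only [cast hld.symm] at h2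
  rcases h1 with ⟨e1, h1⟩ | h1 | ⟨e1, h1⟩ <;> rcases h2 with ⟨e2, h2⟩ | h2 | ⟨e2, h2⟩ <;>
    have h3 := hR _ (h1.trans h2.symm) <;>
    simp only [Prod.mk.injEq, Subtype.mk.injEq, and_true, and_false, reduceCtorEq,
      EmbeddingLike.apply_eq_iff_eq] at h3
  · exact absurd h3 hdd
  · refine Or.inl ⟨e1, ?_⟩
    rw [e1, h3, M.rot_next, M.rev_rev]
  · exact absurd h3 hdd
  · refine Or.inr ⟨e1, ?_⟩
    rw [← h3, M.source_next]
  · exact absurd h3 hdd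

end SurfaceMap
-- Removing two crossings, and counting them
namespace SurfaceMap

variable {δ : Type*} {M : SurfaceMap δ}

theorem ncard_edge (e : M.Edge) : {d | M.edge d = e}.ncard = 2 := by
  obtain ⟨d, rfl⟩ := M.edge_surjective e
  have : {x | M.edge x = M.edge d} = {d, M.rev d} := by
    ext x
    simp only [Set.mem_ofPred_eq, Set.mem_insert_iff, Set.mem_singleton_iff]
    rw [eq_comm, M.edge_eq_iff]
  rw [this, Set.ncard_pair (M.rev_ne d).symm]

variable [Finite δ]

theorem RegionsMeetOnce.preconnected_compl_pair (hN : M.RegionsMeetOnce) (hS : M.RegionsSimple)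
    (h : M.IsFourValent) (hmin : ∀ R, 3 ≤ M.sides R)
    (h2 : ∀ c, (M.graph.induce ({c} : Set M.Crossing)ᶜ).Connected) {u v : M.Crossing}
    (huv : u ≠ v) : (M.graph.induce ({u, v} : Set M.Crossing)ᶜ).Preconnected := by
  by_contra hcon
  simp only [SimpleGraph.Preconnected, not_forall] at hcon
  obtain ⟨⟨a, ha⟩, ⟨b, hb⟩, hab⟩ := hcon
  set S : Set M.Crossing := {u, v}ᶜ with hSdef
  have hmem : ∀ {w}, w ∈ S ↔ w ≠ u ∧ w ≠ v := by
    intro w; simp [hSdef]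
  /- `A` is the component of `a`. -/
  let A : M.Crossing → Prop := fun w => ∃ hw : w ∈ S, (M.graph.induce S).Reachable ⟨a, ha⟩ ⟨w, hw⟩
  have hAa : A a := ⟨ha, .refl _⟩
  have hAb : ¬ A b := fun ⟨_, hr⟩ => hab hr
  have hA1 : ∀ d, M.source (M.rev d) ∈ S → A (M.source d) → A (M.source (M.rev d)) := by
    rintro d hd ⟨hs, hr⟩
    by_cases heq : M.source d = M.source (M.rev d)
    · rw [← heq]; exact ⟨hs, hr⟩
    · refine ⟨hd, hr.trans (SimpleGraph.Adj.reachable ?_)⟩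
      exact ⟨heq, d, rfl, rfl⟩
  have hA : ∀ d, M.source d ∈ S → M.source (M.rev d) ∈ S →
      (A (M.source d) ↔ A (M.source (M.rev d))) := fun d hd hd' =>
    ⟨hA1 d hd', fun hd'' => by
      have := hA1 (M.rev d) (by rwa [M.rev_rev]) hd''
      rwa [M.rev_rev] at this⟩
  have hAS : ∀ {w}, A w → w ∈ S := fun hw => hw.1
  have hAu : ¬ A u := fun hu => (hmem.1 (hAS hu)).1 rfl
  have hloop := hS.source_rev_ne hmin
  -- By connectedness after deleting `v` alone, `u` has a neighbour in `A`; likewise below, one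
  -- outside `A` and different from `v`.
  obtain ⟨α, hαu, hα⟩ : ∃ x, M.source x = u ∧ A (M.source (M.rev x)) := by
    by_contra hno
    push Not at hno
    refine hAb ((eq_of_preconnected_induce (h2 v).preconnected A (fun d hd hd' => propext ?_)
      (hmem.1 ha).2 (hmem.1 hb).2).mp hAa)
    by_cases h1 : M.source d = u
    · exact iff_of_false (h1 ▸ hAu) (hno d h1)
    by_cases h3 : M.source (M.rev d) = u
    · exact iff_of_false (by simpa [M.rev_rev] using hno _ h3) (h3 ▸ hAu)
    exact hA d (hmem.2 ⟨h1, hd⟩) (hmem.2 ⟨h3, hd'⟩)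
  obtain ⟨β, hβu, hβ, hβv⟩ : ∃ x, M.source x = u ∧ ¬ A (M.source (M.rev x)) ∧
      M.source (M.rev x) ≠ v := by
    by_contra hno
    push Not at hno
    refine ((eq_of_preconnected_induce (h2 v).preconnected (fun w => w ≠ u ∧ ¬ A w)
      (fun d hd hd' => propext ?_) (hmem.1 hb).2 (hmem.1 ha).2).mp ⟨(hmem.1 hb).1, hAb⟩).2 hAa
    have hd : M.source d ≠ v := hd
    have hd' : M.source (M.rev d) ≠ v := hd'
    by_cases h1 : M.source d = u
    · exact iff_of_false (fun h => h.1 h1) (fun h => hd' (hno d h1 h.2))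
    by_cases h3 : M.source (M.rev d) = u
    · refine iff_of_false (fun h => hd ?_) (fun h => h.1 h3)
      have := hno (M.rev d) h3
      rw [M.rev_rev] at this
      exact this h.2
    have := hA d (hmem.2 ⟨h1, hd⟩) (hmem.2 ⟨h3, hd'⟩)
    tauto
  /- `V x` says that the region at the corner from `x` to `rot x` meets `v`. -/
  let V : δ → Prop := fun x => ∃ y, M.source y = v ∧ M.left y = M.left x
  have hV1 : ∀ z, ¬ V z → M.source (M.rev z) ≠ v := fun z hz hv =>
    hz ⟨M.next z, by rw [M.source_next, hv], M.left_next z⟩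
  -- Follow the boundary of a region missing `v` from the end of `z` to the end of `rot z`: by
  -- simplicity it avoids `u` in between, so it stays in one component.
  have trace : ∀ T : M.Crossing → Prop, (∀ d, M.source d ∈ S → M.source (M.rev d) ∈ S →
      T (M.source d) → T (M.source (M.rev d))) → ∀ z, M.source z = u → ¬ V z →
      T (M.source (M.rev z)) → T (M.source (M.rev (M.rot z))) := by
    intro T hT z hz hVz hTz
    have := M.left_induction (p := fun x => M.left x = M.left z ∧
      ((M.source x ≠ u ∧ T (M.source x)) ∨ M.source x = u)) ?_ (M.left_rev_rot z).symm
      ⟨rfl, Or.inr hz⟩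
    · rcases this.2 with h1 | h1
      · exact h1.2
      · exact absurd (by rw [h1, M.source_rot, hz]) (hloop (M.rot z))
    · rintro x ⟨hx, hx'⟩
      refine ⟨(M.left_next x).trans hx, ?_⟩
      rw [M.source_next]
      by_cases h3 : M.source (M.rev x) = u
      · exact Or.inr h3
      refine Or.inl ⟨h3, ?_⟩
      rcases hx' with ⟨h1, h1'⟩ | h1
      · have h4 : M.source (M.rev x) ≠ v := fun h4 =>
          hVz ⟨M.next x, by rw [M.source_next, h4], (M.left_next x).trans hx⟩
        exact hT x (hmem.2 ⟨h1, fun h5 => hVz ⟨x, h5, hx⟩⟩) (hmem.2 ⟨h3, h4⟩) h1'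
      · rw [hS (h1.trans hz.symm) hx]; exact hTz
  have same : ∀ z, M.source z = u → ¬ V z →
      (A (M.source (M.rev z)) ↔ A (M.source (M.rev (M.rot z)))) := fun z hz hVz =>
    ⟨trace A (fun d hd hd' => (hA d hd hd').1) z hz hVz, fun h1 => by
      by_contra h3
      exact trace (fun w => ¬ A w) (fun d hd hd' => mt (hA d hd hd').2) z hz hVz h3 h1⟩
  have meet : ∀ z z', M.source z = u → M.source z' = u → z' ≠ z → V z → V z' →
      (z' = M.rot z ∧ M.source (M.rev z') = v) ∨ (z = M.rot z' ∧ M.source (M.rev z) = v) := by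
    rintro z z' hz hz' hne ⟨y, hy, hyl⟩ ⟨y', hy', hyl'⟩
    have := hN (hz'.trans hz.symm) hne (hy'.trans hy.symm) (by rwa [hz, hy]) hyl.symm hyl'.symm
    rwa [hy] at this
  have opp : ∀ z, M.source z = u → ¬ V z ∨ ¬ V (M.rot (M.rot z)) := by
    intro z hz
    by_contra hno
    push Not at hno
    rcases meet z _ hz (by rw [M.source_rot, M.source_rot, hz]) (h.rot_two_ne z) hno.1 hno.2 with
      h1 | h1
    · exact h.rot_ne _ h1.1
    · exact h.rot_three_ne _ h1.1.symm
  -- Two consecutive regions missing `v` put three neighbours of `u` on one side. The fourth dart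
  -- then ends on the other side and not at `v`, so the regions beside it both meet `v`, and `meet`
  -- makes it end at `v` after all.
  have final : ∀ z, M.source z = u → ¬ V z → V (M.rot z) := by
    intro z hz hz0
    by_contra hz1
    have s1 : M.source (M.rot z) = u := by rw [M.source_rot, hz]
    have s2 : M.source (M.rot (M.rot z)) = u := by rw [M.source_rot, s1]
    have s3 : M.source (M.rot (M.rot (M.rot z))) = u := by rw [M.source_rot, s2]
    have t0 := same z hz hz0
    have t1 := same _ s1 hz1
    have key : M.source (M.rev (M.rot (M.rot (M.rot z)))) ≠ v ∧
        ¬ (A (M.source (M.rev (M.rot (M.rot (M.rot z))))) ↔ A (M.source (M.rev z))) := by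
      have hαv : M.source (M.rev α) ≠ v := (hmem.1 (hAS hα)).2
      have hsame : ∀ x, M.source x = u → x ≠ M.rot (M.rot (M.rot z)) →
          (A (M.source (M.rev x)) ↔ A (M.source (M.rev z))) := by
        intro x hx hne
        rcases h.eq_of_source_eq (hx.trans hz.symm) with rfl | rfl | rfl | rfl
        · exact Iff.rfl
        · exact t0.symm
        · exact (t0.trans t1).symm
        · exact absurd rfl hne
      by_cases hα3 : α = M.rot (M.rot (M.rot z))
      · have hβ3 : β ≠ M.rot (M.rot (M.rot z)) := fun hβ3 => hβ (hβ3.trans hα3.symm ▸ hα)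
        rw [← hα3]
        exact ⟨hαv, fun hiff => hβ ((hsame β hβu hβ3).2 (hiff.1 hα))⟩
      · have hzA := (hsame α hαu hα3).1 hα
        have hβ3 : β = M.rot (M.rot (M.rot z)) := by
          by_contra hβ3
          exact hβ ((hsame β hβu hβ3).2 hzA)
        rw [← hβ3]
        exact ⟨hβv, fun hiff => hβ (hiff.2 hzA)⟩
    have v2 : V (M.rot (M.rot z)) := by
      by_contra hv
      exact key.2 ((t0.trans t1).trans (same _ s2 hv)).symm
    have v3 : V (M.rot (M.rot (M.rot z))) := by
      by_contra hv
      have := same _ s3 hv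
      rw [h.rot_four] at this
      exact key.2 this
    rcases meet _ _ s2 s3 (h.rot_ne _) v2 v3 with h1 | h1
    · exact key.1 h1.2
    · exact h.rot_two_ne z (h1.1.trans (h.rot_four z))
  have s1 : M.source (M.rot α) = u := by rw [M.source_rot, hαu]
  have s2 : M.source (M.rot (M.rot α)) = u := by rw [M.source_rot, s1]
  have s3 : M.source (M.rot (M.rot (M.rot α))) = u := by rw [M.source_rot, s2]
  have f0 := final α hαu
  have f1 := final _ s1
  have f2 := final _ s2
  have f3 := final _ s3
  rw [h.rot_four] at f3
  -- Each opposite pair of corners has one missing `v`, so two consecutive corners miss `v`, against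
  -- `final`.
  rcases opp α hαu with o0 | o0
  · rcases opp _ s1 with o1 | o1
    · exact o1 (f0 o0)
    · exact o0 (f3 o1)
  · rcases opp _ s1 with o1 | o1
    · exact o0 (f1 o1)
    · exact o1 (f2 o0)

theorem nat_card_eq_sum_ncard {α : Type*} [Fintype α] (p : δ → α) :
    Nat.card δ = ∑ a, {d | p d = a}.ncard := by
  classical
  have := Fintype.ofFinite δ
  rw [Nat.card_eq_fintype_card, ← Finset.card_univ,
    Finset.card_eq_sum_card_fiberwise (f := p) (t := Finset.univ) (by simp)]
  refine Finset.sum_congr rfl fun a _ => ?_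
  rw [← Set.ncard_coe_finset]
  simp

/-- Here E = 2V and 3F ≤ 2E, while Euler gives F = V + 2. The bound supplies the vertex count in
3-connectivity and a crossing outside any removed pair. -/
theorem six_le_card_crossing (h4 : ∀ c, {d | M.source d = c}.ncard = 4)
    (hmin : ∀ R, 3 ≤ M.sides R)
    (he : Nat.card M.Crossing + Nat.card M.Region = Nat.card M.Edge + 2) :
    6 ≤ Nat.card M.Crossing := by
  have := Fintype.ofFinite M.Crossing
  have := Fintype.ofFinite M.Edge
  have := Fintype.ofFinite M.Region
  have hV := nat_card_eq_sum_ncard M.source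
  have hE := nat_card_eq_sum_ncard M.edge
  have hF := nat_card_eq_sum_ncard M.left
  have hF' : Fintype.card M.Region * 3 ≤ ∑ R, {d | M.left d = R}.ncard := by
    have := Finset.card_nsmul_le_sum Finset.univ M.sides 3 fun R _ => hmin R
    rwa [Finset.card_univ, smul_eq_mul] at this
  simp only [h4, ncard_edge, Finset.sum_const, Finset.card_univ, smul_eq_mul] at hV hE
  simp only [Nat.card_eq_fintype_card (α := M.Crossing), Nat.card_eq_fintype_card (α := M.Edge),
    Nat.card_eq_fintype_card (α := M.Region)] at he ⊢
  omega

end SurfaceMap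

/-! ### The equivalence -/

theorem lemma7p8 {δ : Type*} [Finite δ] (D : DoodleDiagram δ) (hmin : D.IsMinimal)
    (hconn : IsKConnected 2 D.graph) :
    D.IsPrime ↔ ∀ R : D.Region, IsCircle (D.boundary R) := by
  classical
  have h4 := D.toSurfaceMap.isFourValent_of_ncard D.four_valent
  have h2 : ∀ c, (D.graph.induce ({c} : Set D.Crossing)ᶜ).Connected := fun c => by
    have := hconn.2 {c} (by simp)
    rwa [Finset.coe_singleton] at this
  have hS : D.RegionsSimple := fun d s hs hl =>
    h4.region_simple hmin D.connected D.euler h2 hs hl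
  have hcard := SurfaceMap.six_le_card_crossing D.four_valent hmin D.euler
  constructor
  · intro hp R
    have hN := hS.meetOnce_of_connected h4 hmin D.connected D.euler fun u v huv => by
      have := hp.2 {u, v} (by rw [Finset.card_pair huv]; omega)
      rwa [Finset.coe_pair] at this
    exact hS.isCircle_of_linkRegion_injective h4 hmin (hN.linkRegion_injective hS h4 hmin R)
  · intro hR
    have hN := hS.meetOnce_of_linkRegion_injective h4 fun R =>
      hS.linkRegion_injective_of_isCircle h4 hmin (hR R)
    refine ⟨by omega, fun T hT => ?_⟩
    -- Sets of fewer than two crossings are covered by 2-connectivity; only pairs need the regions.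
    by_cases hT2 : T.card < 2
    · exact hconn.2 T hT2
    · obtain ⟨u, v, huv, rfl⟩ := Finset.card_eq_two.1 (show T.card = 2 by omega)
      have hpre := hN.preconnected_compl_pair hS h4 hmin h2 huv
      have : ∃ w, w ∉ ({u, v} : Finset D.Crossing) := by
        by_contra hno
        push Not at hno
        have := Fintype.ofFinite D.Crossing
        have h1 := Finset.card_le_card (fun w _ => hno w :
          (Finset.univ : Finset D.Crossing) ⊆ {u, v})
        rw [Finset.card_univ, ← Nat.card_eq_fintype_card] at h1
        omega
      obtain ⟨w, hw⟩ := this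
      rw [Finset.coe_pair]
      exact { preconnected := hpre, nonempty := ⟨⟨w, by simpa using hw⟩⟩ }
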